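/- **Theorem (strong converse under a maximum photon number constraint).** Let $\mathcal N$ be the single-mode pure-loss bosonic channel of transmissivity $\eta\in[0,1]$, i.e. $\mathcal N(\rho)=\operatorname{Tr}_E\{U(\rho\otimes|0\rangle\langle 0|)U^\dagger\}$, where the beamsplitter $U$ acts by $U|a\rangle|0\rangle=\sum_{k=0}^{a}\sqrt{\binom ak}\,\sqrt{\eta}^{\,k}\sqrt{1-\eta}^{\,a-k}|k\rangle|a-k\rangle$. Let $N_S\ge 0$, let $g(x)=(x+1)\log_2(x+1)-x\log_2 x$ (with $g(0)=0$), and let $\Pi_L$ be the projector of the $n$-mode space onto the span of the number states $|a_1\rangle\otimes\cdots\otimes|a_n\rangle$ with $\sum_i a_i\le L$. A code for $n$ channel uses with $M$ messages consists of arbitrary $n$-mode density operators $\rho_1,\dots,\rho_M$ and a POVM $\Lambda_1,\dots,\Lambda_M$ (so $\Lambda_m\ge 0$ and $\sum_m\Lambda_m=I$); its rate is $R=\frac1n\log_2M$ and its average success probability is $p_{\mathrm{succ}}=\frac1M\sum_m\operatorname{Tr}\{\Lambda_m\mathcal N^{\otimes n}(\rho_m)\}$. 1. Let $n\ge1$,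 $\eta N_S>0$, and consider any code for $n$ uses with $$\frac1M\sum_m\operatorname{Tr}\{\Pi_{\lceil nN_S\rceil}\rho_m\}\ \ge\ 1-\delta_1 .$$ Let $\delta_2,\delta_3>0$ with $\delta_3\le\frac{1}{\lceil nN_S\rceil}(n\delta_2-\eta)$, and let $\delta\ge\frac1n\left(\log_2e+\log_2\left(1+\frac1{\eta N_S}\right)\right)$. Then $$p_{\mathrm{succ}}\ \le\ 2^{-n\left(R-g(\eta N_S+\delta_2)-\delta\right)}+2\sqrt{\delta_1+e^{-2\delta_3^2\eta N_Sn}+2\sqrt{\delta_1}} .$$ If moreover $\eta N_S\ge1$, then also $$p_{\mathrm{succ}}\ \le\ 2^{-n\left(R-g(\eta N_S)-\delta_2-\delta\right)}+2\sqrt{\delta_1+e^{-2\delta_3^2\eta N_Sn}+2\sqrt{\delta_1}} .$$ 2. Let $\eta\in[0,1]$, $N_S\ge0$ and $R>g(\eta N_S)$. For every $n$ let a code for $n$ uses with $M_n$ messages be given, such that for all sufficiently large $n$ its rate $\frac1n\log_2M_n$ is at least $R$ and $\frac1{M_n}\sum_m\operatorname{Tr}\{\Pi_{\lceil nN_S\rceil}\rho_m\}\ge1-\delta_1(n)$,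 where $\delta_1(n)\to0$. Then the average success probability of these codes tends to $0$ as $n\to\infty$. -/

import Mathlib

open Filter Topology

noncomputable section

namespace PureLoss

/-! ### Bosonic Fock space in the photon-number representation -/

/-- The Hilbert space of the bosonic modes labelled by `ι`, in the photon-number representation:
`ℓ²(ℕ^ι)`, i.e. the tensor product over `ι` of the single-mode spaces `ℓ²(ℕ)`. -/
abbrev Fock (ι : Type) : Type := lp (fun _ : ι → ℕ => ℂ) 2

/-- The photon-number state `|a⟩ = ⨂ᵢ |aᵢ⟩`. -/
def ket {ι : Type} [Fintype ι] [DecidableEq ι] (a : ι → ℕ) : Fock ι :=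
  lp.single 2 a (1 : ℂ)

/-- The trace `Tr T = ∑ₐ ⟨a|T|a⟩`, evaluated in the photon-number basis. -/
def trace {ι : Type} [Fintype ι] [DecidableEq ι] (T : Fock ι →L[ℂ] Fock ι) : ℂ :=
  ∑' a : ι → ℕ, inner ℂ (ket a) (T (ket a))

/-- A density operator: positive, trace class, and of trace one.  For a positive operator, being
trace class means that the sum of its diagonal entries converges. -/
structure DensityOperator (ι : Type) [Fintype ι] [DecidableEq ι] where
  op : Fock ι →L[ℂ] Fock ι
  isPositive : op.IsPositive
  hasSum_trace : HasSum (fun a : ι → ℕ => inner ℂ (ket a) (op (ket a))) 1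

/-- The photon number cutoff projector `Π_L = ∑_{a : ∑ᵢ aᵢ ≤ L} |a⟩⟨a|`. -/
def cutoff (ι : Type) [Fintype ι] [DecidableEq ι] (L : ℕ) : Fock ι →L[ℂ] Fock ι :=
  ∑ a ∈ (Fintype.piFinset fun _ : ι => Finset.range (L + 1)).filter (fun a => ∑ i, a i ≤ L),
    InnerProductSpace.rankOne ℂ (ket a) (ket a)

lemma inner_ket {ι : Type} [Fintype ι] [DecidableEq ι] (a b : ι → ℕ) :
    inner ℂ (ket a) (ket b) = if a = b then (1 : ℂ) else 0 := by
  rw [ket, lp.inner_single_left, ket, lp.single_apply]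
  by_cases h : a = b
  · subst h; simp
  · simp [h]

lemma orthonormal_ket {ι : Type} [Fintype ι] [DecidableEq ι] {κ : Type*} {f : κ → ι → ℕ}
    (hf : Function.Injective f) :
    Orthonormal ℂ fun x => ket (f x) := by
  classical
  rw [orthonormal_iff_ite]
  intro x y
  simp [inner_ket, hf.eq_iff]

/-! ### The environment and the partial trace

The modes `ι ⊕ ι` are those of the system (left summand) and of the environment (right summand),
so that `Fock (ι ⊕ ι)` is the tensor product of system and environment, with
`|k⟩ ⊗ |j⟩ = ket (Sum.elim k j)`. -/

lemma orthonormal_ket_sum {ι : Type} [Fintype ι] [DecidableEq ι] (j : ι → ℕ) :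
    Orthonormal ℂ fun k : ι → ℕ => ket (Sum.elim k j) :=
  orthonormal_ket fun k l h => by
    funext i
    simpa using congrFun h (Sum.inl i)

/-- The isometry `|ψ⟩ ↦ |ψ⟩ ⊗ |j⟩` that adjoins an environment in the number state `|j⟩`. -/
def adjoinEnv {ι : Type} [Fintype ι] [DecidableEq ι] (j : ι → ℕ) :
    Fock ι →ₗᵢ[ℂ] Fock (ι ⊕ ι) :=
  (orthonormal_ket_sum j).orthogonalFamily.linearIsometry

/-- The partial trace over the environment, `Tr_E T = ∑ⱼ (I ⊗ ⟨j|) T (I ⊗ |j⟩)`.  For positive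
trace-class `T` the series converges in norm. -/
def partialTraceEnv {ι : Type} [Fintype ι] [DecidableEq ι]
    (T : Fock (ι ⊕ ι) →L[ℂ] Fock (ι ⊕ ι)) : Fock ι →L[ℂ] Fock ι :=
  ∑' j : ι → ℕ, (adjoinEnv j).toContinuousLinearMap.adjoint ∘L T ∘L
    (adjoinEnv j).toContinuousLinearMap

/-! ### The pure-loss channel -/

/-- The single-mode beamsplitter amplitude `⟨k| ⟨a - k| U |a⟩ |0⟩` for `k ≤ a`. -/
def amp (η : unitInterval) (a k : ℕ) : ℝ :=
  √(a.choose k : ℝ) * √(η : ℝ) ^ k * √(1 - (η : ℝ)) ^ (a - k)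

/-- The state `U^{⊗n} (|a⟩ ⊗ |0⟩)` into which beamsplitters of transmissivity `η`, one for each
mode, transform the number state `|a⟩` of the system and the vacuum of the environment; it is the
normalized expansion of `∏ᵢ (√η bᵢ† + √(1-η) eᵢ†)^{aᵢ}` applied to the vacuum. -/
def beamsplitterKet {ι : Type} [Fintype ι] [DecidableEq ι] (η : unitInterval) (a : ι → ℕ) :
    Fock (ι ⊕ ι) :=
  ∑ k ∈ Fintype.piFinset fun i => Finset.range (a i + 1),
    ((∏ i, amp η (a i) (k i) : ℝ) : ℂ) • ket (Sum.elim k fun i => a i - k i)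

lemma sum_amp_sq (η : unitInterval) (a : ℕ) :
    ∑ k ∈ Finset.range (a + 1), amp η a k ^ 2 = 1 := by
  have h : ∀ k ∈ Finset.range (a + 1),
      amp η a k ^ 2 = (η : ℝ) ^ k * (1 - (η : ℝ)) ^ (a - k) * (a.choose k : ℝ) := by
    intro k _
    rw [amp, mul_pow, mul_pow, ← pow_mul, ← pow_mul, mul_comm k, mul_comm (a - k), pow_mul,
      pow_mul, Real.sq_sqrt (Nat.cast_nonneg _), Real.sq_sqrt η.2.1,
      Real.sq_sqrt (sub_nonneg.2 η.2.2)]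
    ring
  rw [Finset.sum_congr rfl h, ← add_pow]
  simp

lemma orthonormal_beamsplitterKet {ι : Type} [Fintype ι] [DecidableEq ι] (η : unitInterval) :
    Orthonormal ℂ (beamsplitterKet (ι := ι) η) := by
  rw [orthonormal_iff_ite]
  intro a b
  simp only [beamsplitterKet, sum_inner, inner_sum, inner_smul_left, inner_smul_right, inner_ket]
  have key : ∀ k ∈ Fintype.piFinset (fun i => Finset.range (a i + 1)),
      ∀ l ∈ Fintype.piFinset (fun i => Finset.range (b i + 1)),
      ((Sum.elim k (fun i => a i - k i) : ι ⊕ ι → ℕ) = Sum.elim l fun i => b i - l i) ↔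
        (a = b ∧ k = l) := by
    intro k hk l hl
    constructor
    · intro h
      have h1 : k = l := by
        funext i; simpa using congrFun h (Sum.inl i)
      refine ⟨?_, h1⟩
      funext i
      have h2 := congrFun h (Sum.inr i)
      have h3 := congrFun h1 i
      have h4 := Finset.mem_range.1 (Fintype.mem_piFinset.1 hk i)
      have h5 := Finset.mem_range.1 (Fintype.mem_piFinset.1 hl i)
      simp only [Sum.elim_inr] at h2
      omega
    · rintro ⟨rfl, rfl⟩; rfl
  split_ifs with hab
  · subst hab
    have h1 : ∀ k ∈ Fintype.piFinset (fun i => Finset.range (a i + 1)),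
        ((∏ i, amp η (a i) (k i) : ℝ) : ℂ) *
          (∑ l ∈ Fintype.piFinset (fun i => Finset.range (a i + 1)),
            (starRingEnd ℂ) ((∏ i, amp η (a i) (l i) : ℝ) : ℂ) *
            if (Sum.elim l (fun i => a i - l i) : ι ⊕ ι → ℕ) = Sum.elim k fun i => a i - k i
              then (1 : ℂ) else 0) = ((∏ i, amp η (a i) (k i) ^ 2 : ℝ) : ℂ) := by
      intro k hk
      rw [Finset.sum_eq_single k]
      · rw [if_pos rfl, mul_one, Complex.conj_ofReal, ← Complex.ofReal_mul,
          ← Finset.prod_mul_distrib]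
        simp only [pow_two]
      · intro l hl hne
        rw [if_neg (fun h => hne ((key l hl k hk).1 h).2), mul_zero]
      · exact fun h => absurd hk h
    have h2 := Finset.prod_univ_sum (fun i => Finset.range (a i + 1))
      (fun i k => amp η (a i) k ^ 2)
    simp only [sum_amp_sq, Finset.prod_const_one] at h2
    rw [Finset.sum_congr rfl h1, ← Complex.ofReal_sum, ← h2, Complex.ofReal_one]
  · refine Finset.sum_eq_zero fun k hk => ?_
    rw [Finset.sum_eq_zero, mul_zero]
    intro l hl
    rw [if_neg (fun h => hab ((key l hl k hk).1 h).1), mul_zero]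

/-- The isometry `|ψ⟩ ↦ U^{⊗n} (|ψ⟩ ⊗ |0⟩)` given by beamsplitters of transmissivity `η` whose
environment ports are in the vacuum state. -/
def beamsplitter {ι : Type} [Fintype ι] [DecidableEq ι] (η : unitInterval) :
    Fock ι →ₗᵢ[ℂ] Fock (ι ⊕ ι) :=
  (orthonormal_beamsplitterKet (ι := ι) η).orthogonalFamily.linearIsometry

/-- The `n`-fold pure-loss bosonic channel
`𝒩^{⊗n}(ρ) = Tr_E [U^{⊗n} (ρ ⊗ |0⟩⟨0|) (U†)^{⊗n}]` of transmissivity `η`, one use of the channel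
for each mode in `ι`. -/
def channel {ι : Type} [Fintype ι] [DecidableEq ι] (η : unitInterval)
    (ρ : Fock ι →L[ℂ] Fock ι) : Fock ι →L[ℂ] Fock ι :=
  partialTraceEnv ((beamsplitter η).toContinuousLinearMap ∘L ρ ∘L
    (beamsplitter η).toContinuousLinearMap.adjoint)

/-! ### Codes -/

/-- A classical code with `M` messages for `n` channel uses: codewords, which are arbitrary
(possibly mixed and entangled) `n`-mode density operators, and a decoding POVM. -/
structure Code (n M : ℕ) where
  codeword : Fin M → DensityOperator (Fin n)
  povm : Fin M → (Fock (Fin n) →L[ℂ] Fock (Fin n))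
  povm_isPositive : ∀ m, (povm m).IsPositive
  povm_sum : ∑ m, povm m = 1

/-- The rate `(log₂ M) / n` of a code. -/
def rate (n M : ℕ) : ℝ := Real.logb 2 M / n

/-- The average success probability `(1/M) ∑ₘ Tr {Λₘ 𝒩^{⊗n}(ρₘ)}`. -/
def Code.successProb {n M : ℕ} (C : Code n M) (η : unitInterval) : ℝ :=
  1 / M * ∑ m, (trace (C.povm m ∘L channel η (C.codeword m).op)).re

/-- The weight `(1/M) ∑ₘ Tr {Π_L ρₘ}` of the average codeword on the subspace of total photon
number at most `L`. -/
def Code.shadow {n M : ℕ} (C : Code n M) (L : ℕ) : ℝ :=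
  1 / M * ∑ m, (trace (cutoff (Fin n) L ∘L (C.codeword m).op)).re

/-- The entropy `g(x) = (x+1) log₂ (x+1) - x log₂ x` of a thermal state of mean photon number
`x`. -/
def g (x : ℝ) : ℝ := (x + 1) * Real.logb 2 (x + 1) - x * Real.logb 2 x

end PureLoss

end

/-! If all channel outputs lay in a subspace of dimension `D`, then `∑ Λₘ = I` would bound the
average success probability by `D / M`. The subspace used here is spanned by the number states with
at most `K = ⌊n (η N_S + δ₂)⌋` photons. Loss thins the photon number distribution binomially
(`hasSum_kraus`), so by Hoeffding an input with at most `⌈n N_S⌉` photons rarely leaves more than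
`K` (`thin_above_le`); and at most `2 ^ (n g(x))` number states have at most `n x` photons
(`card_lowStates_le`).

The outputs lie in the subspace only approximately. States are therefore written as mixtures of
vectors (`IsEnsemble`), and each vector is compared with its truncation (`re_inner_le_of_cutoff`).
The error is made linear in the discarded weight by a free parameter `t`, so it can be summed over
the mixture and averaged over the messages; optimizing `t` last gives `2 √(δ₁ + e)`
(`Code.successProb_le`). This is stronger than the stated bounds, where `δ` and `2 √δ₁` are slack.
-/

noncomputable section

namespace PureLoss

/-! ### Positive trace-class operators as mixtures of pure states -/

section Ensemble

/-- A positive operator has a symmetric square root. -/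
lemma exists_symmetric_sqrt {E : Type*} [NormedAddCommGroup E] [InnerProductSpace ℂ E]
    [CompleteSpace E] {T : E →L[ℂ] E} (hT : T.IsPositive) :
    ∃ S : E →L[ℂ] E, (∀ x y, inner ℂ (S x) y = inner ℂ x (S y)) ∧
      ∀ x y, inner ℂ (S x) (S y) = inner ℂ x (T y) := by
  have h0 : 0 ≤ T := (ContinuousLinearMap.nonneg_iff_isPositive _).2 hT
  have hsym : ∀ x y, inner ℂ (CFC.sqrt T x) y = inner ℂ x (CFC.sqrt T y) :=
    ((ContinuousLinearMap.nonneg_iff_isPositive _).1 (CFC.sqrt_nonneg T)).isSymmetric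
  refine ⟨CFC.sqrt T, hsym, fun x y => ?_⟩
  have h := congrArg (fun A : E →L[ℂ] E => A y) (CFC.sqrt_mul_sqrt_self T h0)
  rw [hsym, ← h]
  rfl

variable {ι : Type} [Fintype ι] [DecidableEq ι]

lemma ket_inner (a : ι → ℕ) (f : Fock ι) : inner ℂ (ket a) f = f a := by
  rw [ket, lp.inner_single_left]; simp

lemma inner_ket_right (f : Fock ι) (a : ι → ℕ) : inner ℂ f (ket a) = (starRingEnd ℂ) (f a) := by
  rw [← inner_conj_symm, ket_inner]

lemma norm_ket (a : ι → ℕ) : ‖ket a‖ = 1 := by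
  rw [ket, lp.norm_single (by norm_num), norm_one]

lemma hasSum_inner_ket (x y : Fock ι) :
    HasSum (fun a => inner ℂ x (ket a) * inner ℂ (ket a) y) (inner ℂ x y) := by
  refine (lp.hasSum_inner x y).congr_fun ?_
  intro a
  rw [ket_inner, inner_ket_right, RCLike.inner_apply, mul_comm]

omit [Fintype ι] [DecidableEq ι] in
lemma hasSum_norm_sq (x : Fock ι) : HasSum (fun a => ‖x a‖ ^ 2) (‖x‖ ^ 2) := by
  have h := Complex.hasSum_re (lp.hasSum_inner x x)
  rw [inner_self_eq_norm_sq_to_K] at h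
  convert h using 1
  · funext a
    rw [inner_self_eq_norm_sq_to_K]; norm_cast
  · norm_cast

/-- The positive operator `T` is the mixture `∑ₖ |φₖ⟩⟨φₖ|` of (unnormalized) pure states. -/
structure IsEnsemble {κ : Type*} (φ : κ → Fock ι) (T : Fock ι →L[ℂ] Fock ι) : Prop where
  summable : Summable fun k => ‖φ k‖ ^ 2
  hasSum_inner : ∀ x y, HasSum (fun k => inner ℂ x (φ k) * inner ℂ (φ k) y) (inner ℂ x (T y))

omit [Fintype ι] [DecidableEq ι] in
lemma norm_inner_mul_inner_le (x y z w : Fock ι) :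
    ‖inner ℂ x y * inner ℂ z w‖ ≤ ‖x‖ * ‖y‖ * (‖z‖ * ‖w‖) := by
  rw [norm_mul]
  exact mul_le_mul (norm_inner_le_norm _ _) (norm_inner_le_norm _ _) (norm_nonneg _) (by positivity)

omit [Fintype ι] [DecidableEq ι] in
/-- A mixture has operator norm at most its total weight. -/
lemma IsEnsemble.norm_le {κ : Type*} {φ : κ → Fock ι} {T : Fock ι →L[ℂ] Fock ι}
    (h : IsEnsemble φ T) : ‖T‖ ≤ ∑' k, ‖φ k‖ ^ 2 := by
  refine ContinuousLinearMap.opNorm_le_of_re_inner_le (tsum_nonneg fun _ => by positivity) ?_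
  intro y x hy hx
  have h1 := h.hasSum_inner x y
  have h2 : ‖inner ℂ x (T y)‖ ≤ ∑' k, ‖φ k‖ ^ 2 := by
    rw [← h1.tsum_eq]
    refine tsum_of_norm_bounded h.summable.hasSum fun k => ?_
    refine (norm_inner_mul_inner_le _ _ _ _).trans (le_of_eq ?_)
    rw [hx, hy]; ring
  refine (RCLike.re_le_norm _).trans ?_
  rwa [← inner_conj_symm, RCLike.norm_conj]

/-- The trace of `Λ T` is the sum of the expectations of `Λ` over the mixture `T`. -/
lemma IsEnsemble.hasSum_trace {κ : Type*} {φ : κ → Fock ι} {T : Fock ι →L[ℂ] Fock ι}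
    (h : IsEnsemble φ T) (Λ : Fock ι →L[ℂ] Fock ι) :
    HasSum (fun k => inner ℂ (φ k) (Λ (φ k))) (trace (Λ ∘L T)) := by
  set F : κ → (ι → ℕ) → ℂ := fun k a => inner ℂ (φ k) (ket a) * inner ℂ (ket a) (Λ (φ k))
    with hF
  have hk : ∀ k, HasSum (F k) (inner ℂ (φ k) (Λ (φ k))) := fun k => hasSum_inner_ket _ _
  have hb : ∀ k, HasSum (fun a => ‖φ k a‖ ^ 2 + ‖Λ (φ k) a‖ ^ 2)
      (‖φ k‖ ^ 2 + ‖Λ (φ k)‖ ^ 2) := fun k => (hasSum_norm_sq _).add (hasSum_norm_sq _)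
  -- Absolute summability justifies exchanging the sums over `k` and `a`; the dominating series has
  -- total at most `(1 + ‖Λ‖²) ∑ ‖φ k‖²`.
  have hsum : Summable (Function.uncurry F) := by
    have hG : Summable fun p : κ × (ι → ℕ) => ‖φ p.1 p.2‖ ^ 2 + ‖Λ (φ p.1) p.2‖ ^ 2 := by
      rw [summable_prod_of_nonneg (fun p => by positivity)]
      refine ⟨fun k => (hb k).summable, ?_⟩
      simp only [fun k => (hb k).tsum_eq]
      refine Summable.of_nonneg_of_le (fun k => by positivity) (fun k => ?_)
        (h.summable.mul_left (1 + ‖Λ‖ ^ 2))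
      have := pow_le_pow_left₀ (norm_nonneg _) (Λ.le_opNorm (φ k)) 2
      rw [mul_pow] at this
      linarith
    refine Summable.of_norm_bounded hG fun p => ?_
    simp only [Function.uncurry, hF, norm_mul, ket_inner, inner_ket_right, RCLike.norm_conj]
    nlinarith [sq_nonneg (‖φ p.1 p.2‖ - ‖Λ (φ p.1) p.2‖), sq_nonneg ‖φ p.1 p.2‖,
      sq_nonneg ‖Λ (φ p.1) p.2‖]
  have ha : ∀ a, HasSum (fun k => F k a) (inner ℂ (ket a) ((Λ ∘L T) (ket a))) := by
    intro a
    have := h.hasSum_inner (Λ.adjoint (ket a)) (ket a)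
    simp only [ContinuousLinearMap.adjoint_inner_left] at this
    refine this.congr_fun fun k => mul_comm _ _
  have h1 := hsum.hasSum.prod_fiberwise hk
  have h2 : ∑' p, Function.uncurry F p = trace (Λ ∘L T) := by
    rw [hsum.tsum_prod' (fun k => (hk k).summable)]
    change ∑' (k) (a), F k a = _
    rw [hsum.tsum_comm.symm, trace]
    exact tsum_congr fun a => (ha a).tsum_eq
  rwa [h2] at h1

lemma IsEnsemble.hasSum_trace_re {κ : Type*} {φ : κ → Fock ι} {T : Fock ι →L[ℂ] Fock ι}
    (h : IsEnsemble φ T) (Λ : Fock ι →L[ℂ] Fock ι) :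
    HasSum (fun k => (inner ℂ (φ k) (Λ (φ k))).re) (trace (Λ ∘L T)).re :=
  Complex.hasSum_re (h.hasSum_trace Λ)

/-- A density operator is the mixture of the images of the number states under its square root. -/
lemma DensityOperator.exists_isEnsemble (ρ : DensityOperator ι) :
    ∃ ψ : (ι → ℕ) → Fock ι, IsEnsemble ψ ρ.op ∧ HasSum (fun b => ‖ψ b‖ ^ 2) 1 := by
  obtain ⟨S, hsym, hin⟩ := exists_symmetric_sqrt ρ.isPositive
  have hw : HasSum (fun b : ι → ℕ => ‖S (ket b)‖ ^ 2) 1 := by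
    have := Complex.hasSum_re ρ.hasSum_trace
    rw [Complex.one_re] at this
    convert this using 2 with b
    rw [← hin, inner_self_eq_norm_sq_to_K]; norm_cast
  refine ⟨fun b => S (ket b), ⟨hw.summable, fun x y => ?_⟩, hw⟩
  have := hasSum_inner_ket (S x) (S y)
  rw [hin] at this
  refine this.congr_fun fun b => ?_
  rw [hsym, hsym]

end Ensemble

/-! ### Kraus operators and binomial thinning of photon numbers -/

section Channel

variable {ι : Type}

lemma IsEnsemble.conj {κ : Type*} {φ : κ → Fock ι} {T : Fock ι →L[ℂ] Fock ι}
    (h : IsEnsemble φ T) (K : Fock ι →L[ℂ] Fock ι) :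
    IsEnsemble (fun k => K (φ k)) (K ∘L T ∘L K.adjoint) where
  summable := by
    refine Summable.of_nonneg_of_le (fun k => by positivity) (fun k => ?_)
      (h.summable.mul_left (‖K‖ ^ 2))
    rw [← mul_pow]
    exact pow_le_pow_left₀ (norm_nonneg _) (K.le_opNorm _) 2
  hasSum_inner x y := by
    have := h.hasSum_inner (K.adjoint x) (K.adjoint y)
    simp only [ContinuousLinearMap.adjoint_inner_left, ContinuousLinearMap.adjoint_inner_right]
      at this
    exact this

/-- The weights bound the operator norms, so the operator series converges in norm and `∑'` is a
genuine sum, not the default value. -/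
lemma IsEnsemble.tsum {κ κ' : Type*} {φ : κ' → κ → Fock ι} {T : κ' → Fock ι →L[ℂ] Fock ι}
    (h : ∀ j, IsEnsemble (φ j) (T j)) (hs : Summable fun p : κ' × κ => ‖φ p.1 p.2‖ ^ 2) :
    IsEnsemble (fun p : κ' × κ => φ p.1 p.2) (∑' j, T j) where
  summable := hs
  hasSum_inner x y := by
    have hT : Summable T := Summable.of_norm_bounded hs.prod fun j => (h j).norm_le
    have h1 : HasSum (fun j => inner ℂ x (T j y)) (inner ℂ x ((∑' j, T j) y)) :=
      (hT.hasSum.mapL (ContinuousLinearMap.apply ℂ (Fock ι) y)).mapL (innerSL ℂ x)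
    have h2 : Summable fun p : κ' × κ => inner ℂ x (φ p.1 p.2) * inner ℂ (φ p.1 p.2) y := by
      refine Summable.of_norm_bounded (hs.mul_left (‖x‖ * ‖y‖)) fun p => ?_
      refine (norm_inner_mul_inner_le _ _ _ _).trans (le_of_eq ?_)
      ring
    have h3 := h2.hasSum.prod_fiberwise fun j => (h j).hasSum_inner x y
    rw [h1.unique h3]
    exact h2.hasSum

variable [Fintype ι] [DecidableEq ι]

/-- The Kraus operators `⟨j|_E U^{⊗n} |0⟩_E` of the pure-loss channel. -/
def kraus (η : unitInterval) (j : ι → ℕ) : Fock ι →L[ℂ] Fock ι :=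
  (adjoinEnv j).toContinuousLinearMap.adjoint ∘L (beamsplitter η).toContinuousLinearMap

lemma channel_eq_tsum (η : unitInterval) (ρ : Fock ι →L[ℂ] Fock ι) :
    channel η ρ = ∑' j, kraus η j ∘L ρ ∘L (kraus η j).adjoint := by
  unfold channel partialTraceEnv
  refine tsum_congr fun j => ?_
  rw [kraus, ContinuousLinearMap.adjoint_comp, ContinuousLinearMap.adjoint_adjoint]
  rfl

lemma adjoinEnv_ket (j k : ι → ℕ) : adjoinEnv j (ket k) = ket (Sum.elim k j) := by
  rw [adjoinEnv, ket, OrthogonalFamily.linearIsometry_apply_single]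
  simp

lemma beamsplitterKet_apply (η : unitInterval) (a k j : ι → ℕ) :
    beamsplitterKet η a (Sum.elim k j) =
      if a = k + j then ((∏ i, amp η (a i) (k i) : ℝ) : ℂ) else 0 := by
  rw [← ket_inner, beamsplitterKet, inner_sum]
  simp only [inner_smul_right, inner_ket]
  split_ifs with h
  · subst h
    rw [Finset.sum_eq_single k]
    · rw [if_pos, mul_one]
      congr 1; funext i; simp
    · intro l _ hl
      rw [if_neg, mul_zero]
      intro h
      exact hl (funext fun i => by simpa using (congrFun h (Sum.inl i)).symm)
    · intro hk
      exact absurd (by simp) hk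
  · refine Finset.sum_eq_zero fun l hl => ?_
    rw [if_neg, mul_zero]
    intro h2
    apply h
    funext i
    have h3 := congrFun h2 (Sum.inl i)
    have h4 := congrFun h2 (Sum.inr i)
    have h5 := Finset.mem_range.1 (Fintype.mem_piFinset.1 hl i)
    simp only [Sum.elim_inl, Sum.elim_inr] at h3 h4
    simp only [Pi.add_apply]
    omega

/-- With `j` photons lost and `k` transmitted, only the input number state `k + j` contributes: each
Kraus operator is a weighted shift. -/
lemma kraus_apply (η : unitInterval) (j : ι → ℕ) (ψ : Fock ι) (k : ι → ℕ) :
    kraus η j ψ k = ((∏ i, amp η ((k + j) i) (k i) : ℝ) : ℂ) * ψ (k + j) := by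
  have h1 : kraus η j ψ k = inner ℂ (ket (Sum.elim k j)) (beamsplitter η ψ) := by
    rw [← ket_inner, kraus, ContinuousLinearMap.comp_apply,
      ContinuousLinearMap.adjoint_inner_right]
    simp [adjoinEnv_ket]
  rw [h1]
  have h2 := ((orthonormal_beamsplitterKet (ι := ι) η).orthogonalFamily.hasSum_linearIsometry
    ψ).mapL (innerSL ℂ (ket (Sum.elim k j)))
  have h3 := hasSum_single (f := fun a => innerSL ℂ (ket (Sum.elim k j))
    (LinearIsometry.toSpanSingleton ℂ (Fock (ι ⊕ ι))
      ((orthonormal_beamsplitterKet (ι := ι) η).1 a) (ψ a))) (k + j) (by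
      intro a ha
      simp [ket_inner, beamsplitterKet_apply, ha])
  refine (h2.unique h3).trans ?_
  simp [ket_inner, beamsplitterKet_apply, mul_comm]

/-- The expectation of `u` under the binomial thinning of the photon numbers `a`. -/
def thin (η : unitInterval) (u : (ι → ℕ) → ℝ) (a : ι → ℕ) : ℝ :=
  ∑ k ∈ Fintype.piFinset fun i => Finset.range (a i + 1), (∏ i, amp η (a i) (k i) ^ 2) * u k

lemma thin_mono (η : unitInterval) {u v : (ι → ℕ) → ℝ} {a : ι → ℕ}
    (h : ∀ k ≤ a, u k ≤ v k) : thin η u a ≤ thin η v a := by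
  refine Finset.sum_le_sum fun k hk => ?_
  refine mul_le_mul_of_nonneg_left (h k fun i => ?_) (by positivity)
  exact Nat.lt_succ_iff.1 (Finset.mem_range.1 (Fintype.mem_piFinset.1 hk i))

lemma thin_prod (η : unitInterval) (f : ι → ℕ → ℝ) (a : ι → ℕ) :
    thin η (fun k => ∏ i, f i (k i)) a =
      ∏ i, ∑ k ∈ Finset.range (a i + 1), amp η (a i) k ^ 2 * f i k := by
  rw [Finset.prod_univ_sum]
  simp only [thin, Finset.prod_mul_distrib]

lemma thin_one (η : unitInterval) (a : ι → ℕ) : thin η (fun _ => 1) a = 1 := by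
  have := thin_prod η (fun _ _ => 1) a
  simpa [sum_amp_sq] using this

lemma thin_zero (η : unitInterval) (a : ι → ℕ) : thin η (fun _ => 0) a = 0 := by
  simp [thin]

lemma thin_le_one (η : unitInterval) {u : (ι → ℕ) → ℝ} (hu : ∀ k, u k ≤ 1) (a : ι → ℕ) :
    thin η u a ≤ 1 := (thin_mono η fun k _ => hu k).trans_eq (thin_one η a)

lemma thin_nonneg (η : unitInterval) {u : (ι → ℕ) → ℝ} (hu : ∀ k, 0 ≤ u k) (a : ι → ℕ) :
    0 ≤ thin η u a := (thin_zero η a).symm.trans_le (thin_mono η fun k _ => hu k)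

lemma summable_thin_mul_norm_sq (η : unitInterval) {u : (ι → ℕ) → ℝ}
    (hu0 : ∀ k, 0 ≤ u k) (hu1 : ∀ k, u k ≤ 1) (ψ : Fock ι) :
    Summable fun a => thin η u a * ‖ψ a‖ ^ 2 :=
  Summable.of_nonneg_of_le (fun a => mul_nonneg (thin_nonneg η hu0 a) (by positivity))
    (fun a => mul_le_of_le_one_left (by positivity) (thin_le_one η hu1 a)) (hasSum_norm_sq ψ).summable

/-- The photon number distribution of the channel output is the binomial thinning of that of the
input. -/
lemma hasSum_kraus (η : unitInterval) {u : (ι → ℕ) → ℝ} (hu0 : ∀ k, 0 ≤ u k)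
    (hu1 : ∀ k, u k ≤ 1) (ψ : Fock ι) :
    HasSum (fun p : (ι → ℕ) × (ι → ℕ) => u p.2 * ‖kraus η p.1 ψ p.2‖ ^ 2)
      (∑' a, thin η u a * ‖ψ a‖ ^ 2) := by
  set G : (ι → ℕ) × (ι → ℕ) → ℝ := fun q =>
    (∏ i, amp η (q.1 i) (q.2 i) ^ 2) * u q.2 * ‖ψ q.1‖ ^ 2 with hG
  have hG0 : ∀ a k : ι → ℕ, ¬ k ≤ a → G (a, k) = 0 := by
    intro a k hk
    obtain ⟨i, hi⟩ : ∃ i, a i < k i := by simpa [Pi.le_def] using hk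
    have : ∏ i, amp η (a i) (k i) ^ 2 = 0 :=
      Finset.prod_eq_zero (Finset.mem_univ i) (by simp [amp, Nat.choose_eq_zero_of_lt hi])
    simp [hG, this]
  have hfib : ∀ a, HasSum (fun k => G (a, k)) (thin η u a * ‖ψ a‖ ^ 2) := by
    intro a
    rw [thin, Finset.sum_mul]
    refine hasSum_sum_of_ne_finset_zero fun k hk => hG0 a k fun h => hk ?_
    exact Fintype.mem_piFinset.2 fun i => Finset.mem_range.2 (Nat.lt_succ_iff.2 (h i))
  have hGs : Summable G := by
    rw [summable_prod_of_nonneg (fun q => by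
      have := hu0 q.2
      change 0 ≤ G q
      positivity)]
    refine ⟨fun a => (hfib a).summable, ?_⟩
    simp only [fun a => (hfib a).tsum_eq]
    exact summable_thin_mul_norm_sq η hu0 hu1 ψ
  have h1 := hGs.hasSum
  rw [← (hGs.hasSum.prod_fiberwise hfib).tsum_eq] at h1
  -- Pairs (lost, transmitted) are reindexed as (input, transmitted). The image is `k ≤ a`, outside
  -- of which the binomial weight vanishes.
  have hinj : Function.Injective fun p : (ι → ℕ) × (ι → ℕ) => (p.2 + p.1, p.2) := by
    rintro ⟨j, k⟩ ⟨j', k'⟩ h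
    simp only [Prod.mk.injEq] at h
    obtain ⟨h1, rfl⟩ := h
    simpa using h1
  rw [← hinj.hasSum_iff] at h1
  · refine h1.congr_fun fun p => ?_
    simp only [hG, Function.comp, kraus_apply, norm_mul, mul_pow, Complex.norm_real, Real.norm_eq_abs,
      sq_abs, Finset.prod_pow]
    ring
  · rintro ⟨a, k⟩ h
    refine hG0 a k fun hk => h ⟨(a - k, k), ?_⟩
    simp [add_tsub_cancel_of_le hk]

/-- Trace preservation: the thinning weights sum to one. -/
lemma hasSum_norm_sq_kraus (η : unitInterval) (ψ : Fock ι) :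
    HasSum (fun j => ‖kraus η j ψ‖ ^ 2) (‖ψ‖ ^ 2) := by
  have h := hasSum_kraus η (u := fun _ => 1) (fun _ => zero_le_one) (fun _ => le_rfl) ψ
  have h1 : ∀ j, HasSum (fun k => 1 * ‖kraus η j ψ k‖ ^ 2) (‖kraus η j ψ‖ ^ 2) := by
    intro j
    simpa only [one_mul] using hasSum_norm_sq (kraus η j ψ)
  have h2 : ∑' a, thin η (fun _ => 1) a * ‖ψ a‖ ^ 2 = ‖ψ‖ ^ 2 := by
    simp only [thin_one, one_mul, (hasSum_norm_sq ψ).tsum_eq]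
  rw [h2] at h
  exact HasSum.prod_fiberwise h h1

/-- The channel output is the mixture of the images of the input mixture under the Kraus
operators. -/
lemma IsEnsemble.channel {κ : Type*} {ψ : κ → Fock ι} {ρ : Fock ι →L[ℂ] Fock ι}
    (h : IsEnsemble ψ ρ) (η : unitInterval) :
    IsEnsemble (fun p : (ι → ℕ) × κ => kraus η p.1 (ψ p.2)) (channel η ρ) := by
  rw [channel_eq_tsum]
  refine IsEnsemble.tsum (φ := fun j b => kraus η j (ψ b)) (fun j => h.conj (kraus η j)) ?_
  rw [← (Equiv.prodComm κ (ι → ℕ)).summable_iff,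
    summable_prod_of_nonneg (fun p => by dsimp; positivity)]
  refine ⟨fun b => (hasSum_norm_sq_kraus η (ψ b)).summable, ?_⟩
  simp only [Function.comp, Equiv.prodComm_apply, Prod.fst_swap, Prod.snd_swap,
    fun b => (hasSum_norm_sq_kraus η (ψ b)).tsum_eq]
  exact h.summable

end Channel

/-! ### Success probability against the dimension of the cutoff subspace -/

section Converse

variable {ι : Type} [Fintype ι] [DecidableEq ι]

/-- The number states with total photon number at most `K`. -/
def lowStates (ι : Type) [Fintype ι] [DecidableEq ι] (K : ℕ) : Finset (ι → ℕ) :=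
  (Fintype.piFinset fun _ : ι => Finset.range (K + 1)).filter (fun a => ∑ i, a i ≤ K)

lemma mem_lowStates {K : ℕ} {a : ι → ℕ} : a ∈ lowStates ι K ↔ ∑ i, a i ≤ K := by
  simp only [lowStates, Finset.mem_filter, Fintype.mem_piFinset, Finset.mem_range,
    and_iff_right_iff_imp]
  intro h i
  have := Finset.single_le_sum (fun i _ => Nat.zero_le (a i)) (Finset.mem_univ i)
  omega

/-- The indicator of a total photon number above `K`. -/
def above (K : ℕ) (a : ι → ℕ) : ℝ := if ∑ i, a i ≤ K then 0 else 1

omit [DecidableEq ι] in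
lemma above_nonneg (K : ℕ) (a : ι → ℕ) : 0 ≤ above K a := by
  unfold above; split_ifs <;> norm_num

omit [DecidableEq ι] in
lemma above_le_one (K : ℕ) (a : ι → ℕ) : above K a ≤ 1 := by
  unfold above; split_ifs <;> norm_num

lemma cutoff_eq_sum (K : ℕ) (φ : Fock ι) :
    cutoff ι K φ = ∑ a ∈ lowStates ι K, φ a • ket a := by
  simp [cutoff, lowStates, ket_inner]

lemma cutoff_apply (K : ℕ) (φ : Fock ι) (a : ι → ℕ) :
    cutoff ι K φ a = if ∑ i, a i ≤ K then φ a else 0 := by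
  rw [← ket_inner, cutoff_eq_sum, inner_sum]
  simp [inner_smul_right, inner_ket, mem_lowStates]

lemma hasSum_norm_sq_sub_cutoff (K : ℕ) (φ : Fock ι) :
    HasSum (fun a => above K a * ‖φ a‖ ^ 2) (‖φ - cutoff ι K φ‖ ^ 2) := by
  refine (hasSum_norm_sq (φ - cutoff ι K φ)).congr_fun fun a => ?_
  rw [lp.coeFn_sub, Pi.sub_apply, cutoff_apply, above]
  split_ifs <;> simp

lemma hasSum_inner_cutoff (K : ℕ) (φ : Fock ι) :
    (inner ℂ φ (cutoff ι K φ)).re = ‖φ‖ ^ 2 - ‖φ - cutoff ι K φ‖ ^ 2 := by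
  have h1 := Complex.hasSum_re (lp.hasSum_inner φ (cutoff ι K φ))
  have h2 := (hasSum_norm_sq φ).sub (hasSum_norm_sq_sub_cutoff K φ)
  refine h1.unique (h2.congr_fun fun a => ?_)
  rw [cutoff_apply, above]
  split_ifs
  · simp only [inner_self_eq_norm_sq_to_K, zero_mul, sub_zero]
    norm_cast
  · simp

lemma norm_sub_cutoff_le (K : ℕ) (φ : Fock ι) : ‖φ - cutoff ι K φ‖ ^ 2 ≤ ‖φ‖ ^ 2 :=
  hasSum_le (fun a => mul_le_of_le_one_left (by positivity) (above_le_one K a))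
    (hasSum_norm_sq_sub_cutoff K φ) (hasSum_norm_sq φ)

lemma norm_cutoff_le (K : ℕ) (φ : Fock ι) : ‖cutoff ι K φ‖ ^ 2 ≤ ‖φ‖ ^ 2 := by
  refine hasSum_le (fun a => ?_) (hasSum_norm_sq _) (hasSum_norm_sq φ)
  rw [cutoff_apply]
  split_ifs
  · exact le_rfl
  · simp

/-- A test on a pure state succeeds at most with its weight on the photon number cutoff subspace,
up to the disturbance by the cutoff. -/
lemma re_inner_le_of_cutoff {Λ : Fock ι →L[ℂ] Fock ι} (hΛ : Λ.IsPositive)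
    (hΛ1 : ∀ v, (inner ℂ v (Λ v)).re ≤ ‖v‖ ^ 2) (K : ℕ) {t : ℝ} (ht : 0 < t) (φ : Fock ι) :
    (inner ℂ φ (Λ φ)).re ≤
      (∑ a ∈ lowStates ι K, (inner ℂ (ket a) (Λ (ket a))).re + t) * ‖φ‖ ^ 2 +
        ‖φ - cutoff ι K φ‖ ^ 2 / t := by
  obtain ⟨S, -, hS⟩ := exists_symmetric_sqrt hΛ
  have hSn : ∀ v, (inner ℂ v (Λ v)).re = ‖S v‖ ^ 2 := by
    intro v
    rw [← hS, inner_self_eq_norm_sq_to_K]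
    norm_cast
  simp only [hSn] at hΛ1 ⊢
  have hS1 : ∀ v, ‖S v‖ ≤ ‖v‖ := fun v => (sq_le_sq₀ (norm_nonneg _) (norm_nonneg _)).1 (hΛ1 v)
  set x := cutoff ι K φ with hx
  have hxφ : ‖x‖ ≤ ‖φ‖ := (sq_le_sq₀ (norm_nonneg _) (norm_nonneg _)).1 (norm_cutoff_le K φ)
  -- Cauchy–Schwarz over the number states. The first factor is `Tr {Π_K Λ}`, which adds up to the
  -- dimension over a POVM.
  have h1 : ‖S x‖ ^ 2 ≤ (∑ a ∈ lowStates ι K, ‖S (ket a)‖ ^ 2) * ‖φ‖ ^ 2 := by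
    have h2 : ‖S x‖ ≤ ∑ a ∈ lowStates ι K, ‖S (ket a)‖ * ‖φ a‖ := by
      rw [hx, cutoff_eq_sum, map_sum]
      refine (norm_sum_le _ _).trans_eq (Finset.sum_congr rfl fun a _ => ?_)
      rw [map_smul, norm_smul, mul_comm]
    refine (pow_le_pow_left₀ (norm_nonneg _) h2 2).trans ?_
    refine (Finset.sum_mul_sq_le_sq_mul_sq _ _ _).trans ?_
    refine mul_le_mul_of_nonneg_left ?_ (Finset.sum_nonneg fun _ _ => by positivity)
    exact sum_le_hasSum _ (fun _ _ => by positivity) (hasSum_norm_sq φ)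
  set y := φ - x with hy
  have hsplit : S φ = S x + S y := by rw [← map_add, hy, add_sub_cancel]
  have h3 : ‖S φ‖ ≤ ‖S x‖ + ‖S y‖ := hsplit ▸ norm_add_le _ _
  have h4 : ‖S φ‖ ^ 2 ≤ ‖S x‖ ^ 2 + 2 * ‖φ‖ * ‖y‖ := by
    have e1 : ‖S φ‖ - ‖S x‖ ≤ ‖y‖ := by linarith [hS1 y]
    have e2 : ‖S φ‖ + ‖S x‖ ≤ 2 * ‖φ‖ := by linarith [hS1 φ, hS1 x]
    nlinarith [norm_nonneg (S φ), norm_nonneg (S x), norm_nonneg y, norm_nonneg φ]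
  -- AM-GM makes the error linear in the weights `‖φ‖²` and `‖y‖²`, hence summable over a mixture.
  have h5 : 2 * ‖φ‖ * ‖y‖ ≤ t * ‖φ‖ ^ 2 + ‖y‖ ^ 2 / t := by
    have : 0 ≤ (t * ‖φ‖ - ‖y‖) ^ 2 / t := by positivity
    have e : (t * ‖φ‖ - ‖y‖) ^ 2 / t = t * ‖φ‖ ^ 2 + ‖y‖ ^ 2 / t - 2 * ‖φ‖ * ‖y‖ := by
      field_simp
      ring
    linarith
  linarith

/-- The success probability of a test on the output of the channel, when all but a weight `e` of
each input number state with at most `L` photons leaves the channel with at most `K` photons. -/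
lemma DensityOperator.trace_channel_le (ρ : DensityOperator ι) (η : unitInterval)
    {Λ : Fock ι →L[ℂ] Fock ι} (hΛ : Λ.IsPositive)
    (hΛ1 : ∀ v, (inner ℂ v (Λ v)).re ≤ ‖v‖ ^ 2) {K L : ℕ} {e : ℝ}
    (he : ∀ a : ι → ℕ, ∑ i, a i ≤ L → thin η (above K) a ≤ e) {t : ℝ} (ht : 0 < t) :
    (trace (Λ ∘L channel η ρ.op)).re ≤
      ∑ a ∈ lowStates ι K, (inner ℂ (ket a) (Λ (ket a))).re + t +
        (e + (1 - (trace (cutoff ι L ∘L ρ.op)).re)) / t := by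
  obtain ⟨ψ, hψ, hψ1⟩ := ρ.exists_isEnsemble
  have he0 : 0 ≤ e := (thin_nonneg η (above_nonneg K) 0).trans (he 0 (by simp))
  have hφ := hψ.channel η
  have hφ1 : HasSum (fun p : (ι → ℕ) × (ι → ℕ) => ‖kraus η p.1 (ψ p.2)‖ ^ 2) 1 := by
    rw [← (Equiv.prodComm (ι → ℕ) (ι → ℕ)).hasSum_iff]
    have hs := (Equiv.prodComm (ι → ℕ) (ι → ℕ)).summable_iff.2 hφ.summable
    have h1 := hs.hasSum.prod_fiberwise (fun b => hasSum_norm_sq_kraus η (ψ b))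
    rw [hψ1.unique h1]
    exact hs.hasSum
  set q : (ι → ℕ) × (ι → ℕ) → ℝ := fun p =>
    ‖kraus η p.1 (ψ p.2) - cutoff ι K (kraus η p.1 (ψ p.2))‖ ^ 2 with hq
  have hqs : Summable q := Summable.of_nonneg_of_le (fun p => by positivity)
    (fun p => norm_sub_cutoff_le K _) hφ1.summable
  have hin : HasSum (fun b => ‖ψ b - cutoff ι L (ψ b)‖ ^ 2)
      (1 - (trace (cutoff ι L ∘L ρ.op)).re) := by
    refine (hψ1.sub (hψ.hasSum_trace_re (cutoff ι L))).congr_fun fun b => ?_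
    rw [hasSum_inner_cutoff]
    ring
  have hqb : ∀ b, HasSum (fun j => q (j, b)) (∑' a, thin η (above K) a * ‖ψ b a‖ ^ 2) := fun b =>
    (hasSum_kraus η (above_nonneg K) (above_le_one K) (ψ b)).prod_fiberwise fun j =>
      hasSum_norm_sq_sub_cutoff K (kraus η j (ψ b))
  -- Input components with at most `L` photons lose a fraction at most `e`; the others lose at most
  -- everything, and their total weight is `1 - Tr {Π_L ρ}`.
  have hq1 : ∑' p, q p ≤ e + (1 - (trace (cutoff ι L ∘L ρ.op)).re) := by
    have hs := (Equiv.prodComm (ι → ℕ) (ι → ℕ)).summable_iff.2 hqs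
    have h1 := HasSum.prod_fiberwise hs.hasSum hqb
    rw [show ∑' p, (q ∘ Equiv.prodComm (ι → ℕ) (ι → ℕ)) p = ∑' p, q p from
      Equiv.tsum_eq _ q] at h1
    have h2 := (hψ1.mul_left e).add hin
    rw [mul_one] at h2
    refine hasSum_le (fun b => ?_) h1 h2
    refine hasSum_le (fun a => ?_)
      (summable_thin_mul_norm_sq η (above_nonneg K) (above_le_one K) (ψ b)).hasSum
      (((hasSum_norm_sq (ψ b)).mul_left e).add (hasSum_norm_sq_sub_cutoff L (ψ b)))
    rw [← add_mul]
    refine mul_le_mul_of_nonneg_right ?_ (by positivity)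
    by_cases ha : ∑ i, a i ≤ L
    · linarith [he a ha, above_nonneg L a]
    · have h1 := thin_le_one η (above_le_one K) a
      rw [above, if_neg ha]
      linarith
  have hfin := hasSum_le (fun p => re_inner_le_of_cutoff hΛ hΛ1 K ht _)
    (hφ.hasSum_trace_re Λ) ((hφ1.mul_left _).add (hqs.hasSum.div_const t))
  rw [mul_one] at hfin
  refine hfin.trans ?_
  have := div_le_div_of_nonneg_right hq1 ht.le
  linarith

variable {n M : ℕ}

lemma Code.sum_re_inner_povm (C : Code n M) (v : Fock (Fin n)) :
    ∑ m, (inner ℂ v (C.povm m v)).re = ‖v‖ ^ 2 := by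
  have h : inner ℂ v ((∑ m, C.povm m) v) = inner ℂ v v := by rw [C.povm_sum]; rfl
  rw [sum_apply, inner_sum, inner_self_eq_norm_sq_to_K] at h
  have h2 := congrArg Complex.re h
  rw [Complex.re_sum] at h2
  rw [h2]
  norm_cast

lemma Code.re_inner_povm_nonneg (C : Code n M) (m : Fin M) (v : Fock (Fin n)) :
    0 ≤ (inner ℂ v (C.povm m v)).re := (C.povm_isPositive m).re_inner_nonneg_right v

lemma Code.re_inner_povm_le (C : Code n M) (m : Fin M) (v : Fock (Fin n)) :
    (inner ℂ v (C.povm m v)).re ≤ ‖v‖ ^ 2 := by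
  rw [← C.sum_re_inner_povm v]
  exact Finset.single_le_sum (f := fun m => (inner ℂ v (C.povm m v)).re)
    (fun m _ => C.re_inner_povm_nonneg m v) (Finset.mem_univ m)

lemma Code.successProb_nonneg (C : Code n M) (η : unitInterval) : 0 ≤ C.successProb η := by
  refine mul_nonneg (by positivity) (Finset.sum_nonneg fun m _ => ?_)
  obtain ⟨ψ, hψ, -⟩ := (C.codeword m).exists_isEnsemble
  exact ((hψ.channel η).hasSum_trace_re (C.povm m)).nonneg fun p => C.re_inner_povm_nonneg m _

/-- The success probability of a code is at most the dimension of the output subspace per message,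
up to the disturbance by the cutoff. -/
lemma Code.successProb_le (C : Code n M) (hM : 0 < M) (η : unitInterval) {K L : ℕ} {e δ₁ : ℝ}
    (hδ : 1 - δ₁ ≤ C.shadow L)
    (he : ∀ a : Fin n → ℕ, ∑ i, a i ≤ L → thin η (above K) a ≤ e) :
    C.successProb η ≤ (lowStates (Fin n) K).card / M + 2 * √(δ₁ + e) := by
  have hM' : (0 : ℝ) < M := by exact_mod_cast hM
  have key : ∀ t : ℝ, 0 < t →
      C.successProb η ≤ (lowStates (Fin n) K).card / M + (t + (δ₁ + e) / t) := by
    intro t ht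
    have h1 := Finset.sum_le_sum fun m (_ : m ∈ Finset.univ) =>
      (C.codeword m).trace_channel_le η (C.povm_isPositive m) (C.re_inner_povm_le m) he ht
    rw [Finset.sum_add_distrib, Finset.sum_add_distrib, Finset.sum_comm, ← Finset.sum_div,
      Finset.sum_add_distrib, Finset.sum_sub_distrib] at h1
    simp only [C.sum_re_inner_povm, norm_ket, one_pow, Finset.sum_const, nsmul_eq_mul, mul_one,
      Finset.card_univ, Fintype.card_fin] at h1
    have h2 := mul_le_mul_of_nonneg_left h1 (by positivity : 0 ≤ 1 / (M : ℝ))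
    refine h2.trans ?_
    have h3 : 1 / (M : ℝ) * ((lowStates (Fin n) K).card + M * t + (M * e +
        (M - ∑ m, (trace (cutoff (Fin n) L ∘L (C.codeword m).op)).re)) / t) =
        (lowStates (Fin n) K).card / M + t + (e + (1 - C.shadow L)) / t := by
      rw [Code.shadow]
      field_simp
    rw [h3]
    have := div_le_div_of_nonneg_right (by linarith : e + (1 - C.shadow L) ≤ δ₁ + e) ht.le
    linarith
  -- The minimizer of `t + (δ₁ + e) / t` is `t = √(δ₁ + e)`. When `δ₁ + e ≤ 0` this is zero and `t →
  -- 0` is used instead.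
  rcases le_or_gt (δ₁ + e) 0 with h0 | h0
  · rw [Real.sqrt_eq_zero_of_nonpos h0, mul_zero, add_zero]
    refine le_of_forall_pos_le_add fun t ht => (key t ht).trans ?_
    linarith [div_nonpos_of_nonpos_of_nonneg h0 ht.le]
  · have h1 := key _ (Real.sqrt_pos.2 h0)
    rw [Real.div_sqrt] at h1
    linarith

end Converse

/-! ### Hoeffding's inequality, counting number states, and the function `g` -/

section Estimates

/-- Hoeffding's lemma for a Bernoulli variable. -/
lemma bernoulli_mgf_le (η : unitInterval) (s : ℝ) :
    (η : ℝ) * Real.exp s + (1 - η) ≤ Real.exp (η * s + s ^ 2 / 8) := by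
  have h := (ProbabilityTheory.hasSubgaussianMGF_of_mem_Icc (X := fun x : ℝ => x)
    (μ := ProbabilityTheory.bernoulliMeasure (1 : ℝ) 0 η) (a := 0) (b := 1)
    measurable_id.aemeasurable (by
      rw [MeasureTheory.ae_iff, ← Set.compl_def,
        ProbabilityTheory.bernoulliMeasure_apply_of_notMem_of_notMem η
          measurableSet_Icc.compl (by simp) (by simp)])).mgf_le s
  simp only [ProbabilityTheory.mgf, ProbabilityTheory.integral_bernoulliMeasure, smul_eq_mul] at h
  have e1 : Real.exp (s * (1 - (η * 1 + (1 - η) * 0))) = Real.exp s * Real.exp (-(η * s)) := by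
    rw [← Real.exp_add]; congr 1; ring
  have e2 : Real.exp (s * (0 - (η * 1 + (1 - η) * 0))) = Real.exp (-(η * s)) := by
    congr 1; ring
  rw [e1, e2] at h
  have e3 : (((‖(1 : ℝ) - 0‖₊ / 2) ^ 2 : NNReal) : ℝ) * s ^ 2 / 2 = s ^ 2 / 8 := by
    simp
    ring
  rw [e3] at h
  rw [Real.exp_add, ← div_le_iff₀' (Real.exp_pos _), div_eq_mul_inv, ← Real.exp_neg]
  linarith

lemma sum_amp_sq_mul_exp (η : unitInterval) (s : ℝ) (a : ℕ) :
    ∑ k ∈ Finset.range (a + 1), amp η a k ^ 2 * Real.exp (s * k) =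
      ((η : ℝ) * Real.exp s + (1 - η)) ^ a := by
  rw [add_pow]
  refine Finset.sum_congr rfl fun k _ => ?_
  rw [amp, mul_pow, mul_pow, ← pow_mul, ← pow_mul, mul_comm k, mul_comm (a - k), pow_mul,
    pow_mul, Real.sq_sqrt (Nat.cast_nonneg _), Real.sq_sqrt η.2.1,
    Real.sq_sqrt (sub_nonneg.2 η.2.2), mul_pow, ← Real.exp_nat_mul, mul_comm s]
  ring

variable {ι : Type} [Fintype ι] [DecidableEq ι]

/-- Hoeffding's inequality for the number of photons that survive the channel. -/
lemma thin_above_le (η : unitInterval) {K L : ℕ} {δ : ℝ} (hδ : 0 ≤ δ)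
    (hK : L * ((η : ℝ) + δ) ≤ K + 1) {a : ι → ℕ} (ha : ∑ i, a i ≤ L) :
    thin η (above K) a ≤ Real.exp (-(2 * δ ^ 2 * L)) := by
  -- This `s` minimizes the Chernoff exponent `L (s² / 8 - s δ)`, with value `-2 δ² L`.
  set s := 4 * δ with hs
  have hη0 : 0 ≤ (η : ℝ) := η.2.1
  have h1 : thin η (above K) a ≤
      thin η (fun k => ∏ i, Real.exp (s * k i)) a *
        Real.exp (-(s * (L * (η + δ)))) := by
    rw [thin, thin, Finset.sum_mul]
    refine Finset.sum_le_sum fun k _ => ?_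
    rw [mul_assoc]
    refine mul_le_mul_of_nonneg_left ?_ (by positivity)
    rw [above]
    split_ifs with hk
    · positivity
    · rw [← Real.exp_sum, ← Real.exp_add, Real.one_le_exp_iff, ← Finset.mul_sum]
      have : (K : ℝ) + 1 ≤ ∑ i, (k i : ℝ) := by exact_mod_cast Nat.lt_of_not_le hk
      have : 0 ≤ s * (∑ i, (k i : ℝ) - L * (η + δ)) :=
        mul_nonneg (by positivity) (by linarith)
      linarith
  rw [thin_prod η (fun _ x => Real.exp (s * x)) a] at h1
  simp only [sum_amp_sq_mul_exp] at h1
  rw [Finset.prod_pow_eq_pow_sum] at h1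
  -- A base of at least one allows the exponent `∑ a i` to be raised to `L`.
  have hbase : 1 ≤ (η : ℝ) * Real.exp s + (1 - η) := by
    have : 1 ≤ Real.exp s := Real.one_le_exp (by positivity)
    nlinarith
  have h2 : ((η : ℝ) * Real.exp s + (1 - η)) ^ (∑ i, a i) ≤
      Real.exp (L * (η * s + s ^ 2 / 8)) := by
    refine (pow_le_pow_right₀ hbase ha).trans ?_
    rw [Real.exp_nat_mul]
    exact pow_le_pow_left₀ (by linarith) (bernoulli_mgf_le η s) L
  refine h1.trans ((mul_le_mul_of_nonneg_right h2 (Real.exp_nonneg _)).trans_eq ?_)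
  rw [← Real.exp_add]
  congr 1
  rw [hs]
  ring

lemma two_rpow_g {x : ℝ} (hx : 0 < x) (n : ℕ) :
    (2 : ℝ) ^ (n * g x) = (x + 1) ^ n * (x / (x + 1)) ^ (-(n * x)) := by
  have hx1 : 0 < x + 1 := by linarith
  have hl : Real.log 2 ≠ 0 := (Real.log_pos one_lt_two).ne'
  rw [Real.rpow_def_of_pos two_pos, Real.rpow_def_of_pos (by positivity),
    ← Real.exp_log (pow_pos hx1 n), ← Real.exp_add, Real.log_pow,
    Real.log_div hx.ne' hx1.ne', g, Real.logb, Real.logb]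
  congr 1
  field_simp
  ring

lemma g_zero : g 0 = 0 := by simp [g]

lemma card_lowStates_zero : (lowStates ι 0).card = 1 := by
  rw [Finset.card_eq_one]
  refine ⟨0, ?_⟩
  ext a
  simp [mem_lowStates, funext_iff]

/-- The number of `n`-mode number states with at most `n x` photons is at most `2 ^ (n g(x))`. -/
lemma card_lowStates_le {n K : ℕ} {x : ℝ} (hx : 0 ≤ x) (hK : K ≤ n * x) :
    ((lowStates (Fin n) K).card : ℝ) ≤ 2 ^ (n * g x) := by
  rcases hx.eq_or_lt with rfl | hx
  · have : K = 0 := by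
      rw [mul_zero] at hK
      exact_mod_cast le_antisymm hK (Nat.cast_nonneg K)
    subst this
    simp [card_lowStates_zero, g_zero]
  have hx1 : 0 < x + 1 := by linarith
  -- Weight each number state by `r ^ ∑ a i`: a counted state has weight at least `r ^ (n x)`, and
  -- all states together weigh `(1 - r)⁻ⁿ`. This `r` minimizes `r ^ (-x) / (1 - r)`, whose minimum
  -- is `2 ^ g(x)`.
  set r := x / (x + 1) with hr
  have hr0 : 0 < r := by positivity
  have hr1 : r < 1 := (div_lt_one hx1).2 (by linarith)
  have h1 : ∀ a ∈ lowStates (Fin n) K, r ^ (n * x) ≤ ∏ i, r ^ a i := by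
    intro a ha
    rw [Finset.prod_pow_eq_pow_sum, ← Real.rpow_natCast]
    refine Real.rpow_le_rpow_of_exponent_ge hr0 hr1.le (le_trans ?_ hK)
    exact_mod_cast mem_lowStates.1 ha
  have h2 := (Finset.card_nsmul_le_sum _ _ _ h1).trans
    (Finset.sum_le_sum_of_subset_of_nonneg (Finset.filter_subset _ _)
      fun _ _ _ => by positivity)
  rw [← Finset.prod_univ_sum, Finset.prod_const, Finset.card_univ, Fintype.card_fin,
    nsmul_eq_mul] at h2
  have h3 : ∑ k ∈ Finset.range (K + 1), r ^ k ≤ x + 1 := by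
    have h4 := hasSum_geometric_of_lt_one hr0.le hr1
    have h5 : (1 - r)⁻¹ = x + 1 := by
      rw [hr]
      field_simp
      ring
    rw [h5] at h4
    exact sum_le_hasSum _ (fun _ _ => by positivity) h4
  have h4 := h2.trans (pow_le_pow_left₀ (Finset.sum_nonneg fun _ _ => by positivity) h3 n)
  rw [two_rpow_g hx, Real.rpow_neg hr0.le, ← div_eq_mul_inv, le_div_iff₀ (Real.rpow_pos_of_pos hr0 _)]
  exact h4

lemma two_rpow_rate {n M : ℕ} (hn : 0 < n) (hM : 0 < M) : (2 : ℝ) ^ (n * rate n M) = M := by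
  have hn' : (n : ℝ) ≠ 0 := by exact_mod_cast hn.ne'
  rw [rate, mul_div_cancel₀ _ hn', Real.rpow_logb two_pos (by norm_num) (by exact_mod_cast hM)]

lemma Code.successProb_le_rpow {n M : ℕ} (C : Code n M) (hn : 0 < n) (η : unitInterval)
    {K L : ℕ} {e δ₁ x : ℝ} (hx : 0 ≤ x) (hK : K ≤ n * x) (hδ : 1 - δ₁ ≤ C.shadow L)
    (he : ∀ a : Fin n → ℕ, ∑ i, a i ≤ L → thin η (above K) a ≤ e) :
    C.successProb η ≤ 2 ^ (-(n * (rate n M - g x))) + 2 * √(δ₁ + e) := by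
  -- Without messages the success probability is zero, as `1 / 0 = 0`.
  rcases Nat.eq_zero_or_pos M with rfl | hM
  · simp only [Code.successProb, Nat.cast_zero, div_zero, zero_mul]
    positivity
  refine (C.successProb_le hM η hδ he).trans ?_
  gcongr
  rw [show -(n * (rate n M - g x)) = n * g x - n * rate n M by ring, Real.rpow_sub two_pos,
    two_rpow_rate hn hM]
  gcongr
  exact card_lowStates_le hx hK

lemma hasDerivAt_g {x : ℝ} (hx : 0 < x) : HasDerivAt g (Real.logb 2 (x + 1) - Real.logb 2 x) x := by
  have hx1 : x + 1 ≠ 0 := by linarith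
  have h1 : HasDerivAt (fun y : ℝ => y + 1) 1 x := (hasDerivAt_id x).add_const 1
  have h2 : HasDerivAt (fun y : ℝ => Real.logb 2 (y + 1)) (1 / (x + 1) / Real.log 2) x :=
    (h1.log hx1).div_const _
  have h3 : HasDerivAt (fun y : ℝ => Real.logb 2 y) (x⁻¹ / Real.log 2) x :=
    (Real.hasDerivAt_log hx.ne').div_const _
  refine ((h1.mul h2).sub ((hasDerivAt_id x).mul h3)).congr_deriv ?_
  simp only [id]
  field_simp
  ring

/-- The derivative `log₂ (1 + 1 / y)` of `g` is at most one exactly when `y ≥ 1`. -/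
lemma g_add_le {x d : ℝ} (hx : 1 ≤ x) (hd : 0 ≤ d) : g (x + d) ≤ g x + d := by
  have hder : ∀ y, 1 ≤ y → HasDerivAt (fun z => g z - z)
      (Real.logb 2 (y + 1) - Real.logb 2 y - 1) y := fun y hy =>
    (hasDerivAt_g (by linarith)).sub (hasDerivAt_id y)
  have hanti : AntitoneOn (fun z => g z - z) (Set.Ici 1) := by
    refine antitoneOn_of_deriv_nonpos (convex_Ici 1)
      (fun y hy => (hder y hy).continuousAt.continuousWithinAt)
      (fun y hy => (hder y (interior_subset hy)).differentiableAt.differentiableWithinAt) ?_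
    intro y hy
    have hy1 : 1 ≤ y := interior_subset hy
    rw [(hder y hy1).deriv]
    have h2 : Real.logb 2 (y + 1) ≤ Real.logb 2 (2 * y) :=
      Real.logb_le_logb_of_le one_lt_two (by linarith) (by linarith)
    rw [Real.logb_mul (by norm_num) (by linarith), Real.logb_self_eq_one one_lt_two] at h2
    linarith
  have := hanti (Set.mem_Ici.2 hx) (Set.mem_Ici.2 (by linarith : 1 ≤ x + d)) (by linarith)
  simp only at this
  linarith

end Estimates

/-! ### Finite-length bounds and a uniform exponent -/

section StrongConverse

lemma Code.successProb_le_hoeffding {n M : ℕ} (C : Code n M) (hn : 0 < n) (η : unitInterval)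
    {N_S δ₁ δ₂ δ₃ : ℝ} (hN : 0 ≤ N_S) (hδ : 1 - δ₁ ≤ C.shadow ⌈n * N_S⌉₊) (hδ₂ : 0 ≤ δ₂)
    (hδ₃ : 0 ≤ δ₃) (h23 : δ₃ * ⌈n * N_S⌉₊ ≤ n * δ₂ - η) :
    C.successProb η ≤ 2 ^ (-(n * (rate n M - g (η * N_S + δ₂)))) +
      2 * √(δ₁ + Real.exp (-(2 * δ₃ ^ 2 * (η * N_S)) * n)) := by
  have hη0 : 0 ≤ (η : ℝ) := η.2.1
  have hη1 : (η : ℝ) ≤ 1 := η.2.2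
  set L := ⌈n * N_S⌉₊ with hL
  have hL1 : n * N_S ≤ L := Nat.le_ceil _
  have hL2 : (L : ℝ) < n * N_S + 1 := Nat.ceil_lt_add_one (by positivity)
  have hx : 0 ≤ (η : ℝ) * N_S + δ₂ := by positivity
  refine C.successProb_le_rpow hn η hx (Nat.floor_le (by positivity)) hδ fun a ha => ?_
  -- Rounding `n N_S` up to `L` costs at most `η` transmitted photons on average, which the `-η` in
  -- `h23` pays for.
  have hK : L * ((η : ℝ) + δ₃) ≤ (⌊n * ((η : ℝ) * N_S + δ₂)⌋₊ : ℝ) + 1 := by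
    have h1 := Nat.lt_floor_add_one (n * ((η : ℝ) * N_S + δ₂))
    have h2 : (L : ℝ) * η ≤ (n * N_S + 1) * η := mul_le_mul_of_nonneg_right hL2.le hη0
    nlinarith
  refine (thin_above_le η hδ₃ hK ha).trans (Real.exp_le_exp.2 ?_)
  have h3 : (η : ℝ) * N_S * n ≤ L := by
    have : (η : ℝ) * (n * N_S) ≤ n * N_S := mul_le_of_le_one_left (by positivity) hη1
    linarith
  have h4 := mul_le_mul_of_nonneg_left h3 (by positivity : 0 ≤ 2 * δ₃ ^ 2)
  linarith

lemma thin_above_zero {ι : Type} [Fintype ι] [DecidableEq ι] {η : unitInterval} {a : ι → ℕ}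
    (h : (η : ℝ) = 0 ∨ ∑ i, a i ≤ 0) : thin η (above 0) a ≤ 0 := by
  refine Finset.sum_nonpos fun k hk => ?_
  rw [above]
  split_ifs with hk0
  · simp
  obtain ⟨i, hi⟩ : ∃ i, k i ≠ 0 := by
    by_contra! h0
    exact hk0 (by simp [h0])
  rw [Finset.prod_eq_zero (Finset.mem_univ i), zero_mul]
  rcases h with h | h
  · simp [amp, h, hi]
  · have h1 := Finset.mem_range.1 (Fintype.mem_piFinset.1 hk i)
    have h2 := Finset.single_le_sum (fun i _ => Nat.zero_le (a i)) (Finset.mem_univ i)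
    omega

/-- Hoeffding's exponent degenerates here, but inputs within the cutoff leave the channel exactly in
the vacuum: nothing is sent or nothing is transmitted. -/
lemma Code.successProb_le_of_mul_eq_zero {n M : ℕ} (C : Code n M) (hn : 0 < n) (η : unitInterval)
    {N_S δ₁ : ℝ} (h0 : (η : ℝ) * N_S = 0) (hδ : 1 - δ₁ ≤ C.shadow ⌈n * N_S⌉₊) :
    C.successProb η ≤ 2 ^ (-(n * (rate n M - g 0))) + 2 * √(δ₁ + 0) := by
  refine C.successProb_le_rpow hn η le_rfl (K := 0) (by simp) hδ fun a ha => thin_above_zero ?_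
  refine (mul_eq_zero.1 h0).imp_right fun h => ?_
  simpa [h] using ha

/-- Merges the cases `η N_S = 0` and `η N_S > 0`; `G` and `e` do not depend on the code. -/
lemma exists_exponent (η : unitInterval) {N_S R : ℝ} (hN : 0 ≤ N_S) (hR : g (η * N_S) < R) :
    ∃ G < R, ∃ e : ℕ → ℝ, Tendsto e atTop (𝓝 0) ∧ ∀ᶠ n : ℕ in atTop,
      ∀ (M : ℕ) (C : Code n M) (δ₁ : ℝ), 1 - δ₁ ≤ C.shadow ⌈n * N_S⌉₊ →
        C.successProb η ≤ 2 ^ (-(n * (rate n M - G))) + 2 * √(δ₁ + e n) := by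
  have hη0 : 0 ≤ (η : ℝ) := η.2.1
  rcases (mul_nonneg hη0 hN).eq_or_lt with h0 | hx
  · refine ⟨g 0, by rwa [h0], fun _ => 0, tendsto_const_nhds, ?_⟩
    filter_upwards [eventually_gt_atTop 0] with n hn M C δ₁ hδ
    exact C.successProb_le_of_mul_eq_zero hn η h0.symm hδ
  have hN0 : 0 < N_S := by
    refine hN.lt_of_ne fun h => ?_
    rw [← h, mul_zero] at hx
    exact lt_irrefl _ hx
  obtain ⟨δ₂, hδ₂, hG⟩ : ∃ δ₂ > 0, g (η * N_S + δ₂) < R := by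
    have h1 := (hasDerivAt_g hx).continuousAt.eventually_lt continuousAt_const hR
    obtain ⟨ε, hε, h⟩ := Metric.eventually_nhds_iff.1 h1
    refine ⟨ε / 2, by positivity, h ?_⟩
    rw [Real.dist_eq, add_sub_cancel_left, abs_of_pos (by positivity)]
    linarith
  -- Then `δ₃ n N_S` uses half of `n δ₂`; for large `n` the other half absorbs `η + δ₃`.
  set δ₃ := δ₂ / (2 * N_S) with hδ₃
  have hδ₃0 : 0 < δ₃ := by positivity
  refine ⟨_, hG, fun n => Real.exp (-(2 * δ₃ ^ 2 * (η * N_S)) * n), ?_, ?_⟩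
  · refine Real.tendsto_exp_atBot.comp (tendsto_natCast_atTop_atTop.const_mul_atTop_of_neg ?_)
    have : 0 < 2 * δ₃ ^ 2 * (η * N_S) := by positivity
    linarith
  · filter_upwards [eventually_gt_atTop 0,
      tendsto_natCast_atTop_atTop.eventually_ge_atTop ((η + δ₃) / (δ₂ / 2))] with n hn hn2 M C δ₁ hδ
    refine C.successProb_le_hoeffding hn η hN hδ hδ₂.le hδ₃0.le ?_
    rw [div_le_iff₀ (by positivity)] at hn2
    have h1 : (⌈n * N_S⌉₊ : ℝ) ≤ n * N_S + 1 := (Nat.ceil_lt_add_one (by positivity)).le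
    have h2 := mul_le_mul_of_nonneg_left h1 hδ₃0.le
    have h3 : δ₃ * (n * N_S + 1) = n * (δ₂ / 2) + δ₃ := by
      rw [hδ₃]
      field_simp
    linarith

end StrongConverse

end PureLoss

end

theorem mainTheorem1 (η : unitInterval) (N_S : ℝ) (hN_S : 0 ≤ N_S) :
    (∀ (n M : ℕ) (C : PureLoss.Code n M) (δ₁ δ₂ δ₃ δ : ℝ),
      0 < n → 0 < (η : ℝ) * N_S →
      1 - δ₁ ≤ C.shadow ⌈n * N_S⌉₊ →
      0 < δ₂ → 0 < δ₃ → δ₃ ≤ 1 / (⌈n * N_S⌉₊ : ℝ) * (n * δ₂ - η) →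
      1 / n * (Real.logb 2 (Real.exp 1) + Real.logb 2 (1 + 1 / (η * N_S))) ≤ δ →
      C.successProb η ≤
          (2 : ℝ) ^ (-(n * (PureLoss.rate n M - PureLoss.g (η * N_S + δ₂) - δ)))
            + 2 * √(δ₁ + Real.exp (-(2 * δ₃ ^ 2 * (η * N_S)) * n) + 2 * √δ₁) ∧
      (1 ≤ (η : ℝ) * N_S →
        C.successProb η ≤
          (2 : ℝ) ^ (-(n * (PureLoss.rate n M - PureLoss.g (η * N_S) - δ₂ - δ)))
            + 2 * √(δ₁ + Real.exp (-(2 * δ₃ ^ 2 * (η * N_S)) * n) + 2 * √δ₁))) ∧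
    (∀ (R : ℝ) (M : ℕ → ℕ) (C : ∀ n, PureLoss.Code n (M n)) (δ₁ : ℕ → ℝ),
      PureLoss.g (η * N_S) < R →
      (∀ᶠ n in atTop, R ≤ PureLoss.rate n (M n)) →
      (∀ᶠ n in atTop, 1 - δ₁ n ≤ (C n).shadow ⌈n * N_S⌉₊) →
      Tendsto δ₁ atTop (𝓝 0) →
      Tendsto (fun n => (C n).successProb η) atTop (𝓝 0)) := by
  constructor
  · intro n M C δ₁ δ₂ δ₃ δ hn hx hδ₁ hδ₂ hδ₃ h23 hδ
    have hn' : (0 : ℝ) < n := by exact_mod_cast hn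
    have hN : 0 < N_S := by
      refine hN_S.lt_of_ne fun h => ?_
      rw [← h, mul_zero] at hx
      exact lt_irrefl _ hx
    have hL : (0 : ℝ) < ⌈n * N_S⌉₊ := by exact_mod_cast Nat.ceil_pos.2 (by positivity)
    rw [one_div, ← div_eq_inv_mul, le_div_iff₀ hL] at h23
    have hδ0 : 0 ≤ δ := by
      refine le_trans (mul_nonneg (by positivity) (add_nonneg ?_ ?_)) hδ
      · exact Real.logb_nonneg one_lt_two (Real.one_le_exp zero_le_one)
      · exact Real.logb_nonneg one_lt_two (le_add_of_nonneg_right (by positivity))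
    have h1 := C.successProb_le_hoeffding hn η hN_S hδ₁ hδ₂.le hδ₃.le h23
    have h2 : √(δ₁ + Real.exp (-(2 * δ₃ ^ 2 * (η * N_S)) * n)) ≤
        √(δ₁ + Real.exp (-(2 * δ₃ ^ 2 * (η * N_S)) * n) + 2 * √δ₁) :=
      Real.sqrt_le_sqrt (le_add_of_nonneg_right (by positivity))
    -- Lowering the exponent only weakens the bound, so both claims reduce to comparing exponents.
    have h3 : ∀ y, PureLoss.rate n M - PureLoss.g (η * N_S + δ₂) ≥ y →
        C.successProb η ≤ (2 : ℝ) ^ (-(n * y)) +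
          2 * √(δ₁ + Real.exp (-(2 * δ₃ ^ 2 * (η * N_S)) * n) + 2 * √δ₁) := by
      intro y hy
      have h4 : (2 : ℝ) ^ (-(n * (PureLoss.rate n M - PureLoss.g (η * N_S + δ₂)))) ≤
          (2 : ℝ) ^ (-(n * y)) :=
        Real.rpow_le_rpow_of_exponent_le one_le_two
          (neg_le_neg (mul_le_mul_of_nonneg_left hy hn'.le))
      linarith
    refine ⟨h3 _ (by linarith), fun hx1 => h3 _ ?_⟩
    linarith [PureLoss.g_add_le hx1 hδ₂.le]
  · intro R M C δ₁ hR hrate hshadow hδ₁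
    obtain ⟨G, hG, e, he, hev⟩ := PureLoss.exists_exponent η hN_S hR
    have hlim : Tendsto (fun n : ℕ => (2 : ℝ) ^ (-(n * (R - G))) + 2 * √(δ₁ n + e n)) atTop
        (𝓝 0) := by
      have h1 : Tendsto (fun n : ℕ => (2 : ℝ) ^ (-(n * (R - G)))) atTop (𝓝 0) := by
        refine (tendsto_rpow_atBot_of_base_gt_one 2 one_lt_two).comp ?_
        exact tendsto_neg_atTop_atBot.comp
          (tendsto_natCast_atTop_atTop.atTop_mul_const (by linarith))
      have h2 := ((hδ₁.add he).sqrt).const_mul 2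
      simpa using h1.add h2
    refine tendsto_of_tendsto_of_tendsto_of_le_of_le' tendsto_const_nhds hlim
      (Eventually.of_forall fun n => (C n).successProb_nonneg η) ?_
    filter_upwards [hrate, hshadow, hev] with n hn1 hn2 hn3
    refine (hn3 _ (C n) _ hn2).trans ?_
    gcongr
    exact one_le_two
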